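/- Consider interactive proof systems whose (private-coin) verifier is a sweeping probabilistic finite automaton (PFA). The verifier is a two-way PFA with arbitrary real transition probabilities and no work tape. It reads its input $w$ on the tape $¢ w \$$, has a head that changes direction only on the end-markers, and exchanges symbols of a finite communication alphabet with a prover; the prover sees only the input and the symbols sent by the verifier. Such a verifier verifies a language $L$ with error bound $\epsilon<\frac12$ if (1) some prover makes it accept every $w\in L$ with probability at least $1-\epsilon$, and (2) with every prover it rejects every $w\notin L$ with probability at least $1-\epsilon$. It runs in linear time if, with every prover, every computation path on an input of length $n$ halts within $O(n)$ steps (at most $c(n+1)$ steps, for a constant $c$ depending only on the verifier). Let $$\mathtt{DIMA2}=\{0^{2^0}10^{2^1}10^{2^2}1\cdots 10^{2^{3k-1}}11(0^{2^{3k}}1)^{2^{3k}} \mid k>0\},$$ let $w_k$ be the $k$-th shortest member of $\mathtt{DIMA2}$, and for $I\subseteq\mathbb{Z}^+$ let $\mathtt{DIMA2}(I)=\{w_k\mid k\in I\}$. Theorem. For every $I\subseteq\mathbb{Z}^+$, the language $\mathtt{DIMA2}(I)$ is verified with bounded error (some error bound $\epsilon<\frac12$) in linear time by a sweeping PFA verifier.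 Consequently, the set of binary languages that are verified with bounded error in linear time by sweeping PFA verifiers is uncountable. -/

import Mathlib

/-- The contents of a cell of the input tape: the left end-marker, the right end-marker, or an
input symbol. -/
inductive TapeSymbol (α : Type) : Type
  | leftEnd : TapeSymbol α
  | rightEnd : TapeSymbol α
  | sym (a : α) : TapeSymbol α

/-- The input `w` is written on the cells `1, …, |w|`, between the left end-marker on cell `0` and
the right end-marker on cell `|w| + 1`. -/
def tapeCell {α : Type} (w : List α) (p : ℕ) : TapeSymbol α :=
  if p = 0 then TapeSymbol.leftEnd
  else match w[p - 1]? with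
    | some a => TapeSymbol.sym a
    | none => TapeSymbol.rightEnd

/-- The moves of the input head. -/
inductive HeadMove : Type
  | left : HeadMove
  | stay : HeadMove
  | right : HeadMove

/-- The head position after a move from position `p`. -/
def HeadMove.apply (d : HeadMove) (p : ℕ) : ℕ :=
  match d with
  | HeadMove.left => p - 1
  | HeadMove.stay => p
  | HeadMove.right => p + 1

/-- The states of a verifier: reading states, communicating states, and the two halting states. -/
inductive VerifierState (R C : Type) : Type
  | read (r : R) : VerifierState R C
  | comm (c : C) : VerifierState R C
  | accept : VerifierState R C
  | reject : VerifierState R C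

/-- A two-way probabilistic finite automaton verifier (a verifier without work tape) with input
alphabet `α`. The transition probabilities are arbitrary real numbers. -/
structure PFAVerifier (α : Type) : Type 1 where
  /-- the reading states -/
  ReadState : Type
  /-- the communicating states -/
  CommState : Type
  /-- the communication alphabet -/
  Msg : Type
  finite_readState : Finite ReadState
  finite_commState : Finite CommState
  finite_msg : Finite Msg
  nonempty_msg : Nonempty Msg
  /-- the initial state, a reading state -/
  init : ReadState
  /-- in a reading state: the distribution of the next state and of the head move, given the
  symbol under the input head -/
  readStep : ReadState → TapeSymbol α → PMF (VerifierState ReadState CommState × HeadMove)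
  /-- in a communicating state: the symbol written on the communication cell -/
  send : CommState → Msg
  /-- in a communicating state: the next state, given the symbol written back by the prover -/
  receive : CommState → Msg → VerifierState ReadState CommState
  /-- the head never leaves the tape on the left -/
  not_left_of_leftEnd : ∀ (r : ReadState) (s : VerifierState ReadState CommState),
    (s, HeadMove.left) ∉ (readStep r TapeSymbol.leftEnd).support
  /-- the head never leaves the tape on the right -/
  not_right_of_rightEnd : ∀ (r : ReadState) (s : VerifierState ReadState CommState),
    (s, HeadMove.right) ∉ (readStep r TapeSymbol.rightEnd).support

namespace PFAVerifier

variable {α : Type}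

/-- The states of `V`. -/
abbrev State (V : PFAVerifier α) : Type := VerifierState V.ReadState V.CommState

/-- A prover for `V`: it answers on the basis of the input and of the symbols that `V` has written
on the communication cell so far (most recent first), and of nothing else. Its computational power
is unlimited. -/
abbrev Prover (V : PFAVerifier α) : Type := List α → List V.Msg → V.Msg

/-- A configuration on a given input: the state, the position of the input head, and the symbols
written so far on the communication cell by the verifier (most recent first). -/
structure Config (V : PFAVerifier α) : Type where
  state : V.State
  pos : ℕ
  sent : List V.Msg

/-- The initial configuration: the head is on the left end-marker, nothing has been sent. -/
def initConfig (V : PFAVerifier α) : V.Config := ⟨VerifierState.read V.init, 0, []⟩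

/-- The distribution of the configuration after one step, when `V` works on the input `w` and
communicates with the prover `P`. A halted computation stays as it is. -/
noncomputable def step (V : PFAVerifier α) (P : V.Prover) (w : List α) (c : V.Config) :
    PMF V.Config :=
  match c.state with
  | VerifierState.read r =>
      (V.readStep r (tapeCell w c.pos)).map fun x => ⟨x.1, x.2.apply c.pos, c.sent⟩
  | VerifierState.comm q =>
      PMF.pure ⟨V.receive q (P w (V.send q :: c.sent)), c.pos, V.send q :: c.sent⟩
  | VerifierState.accept => PMF.pure c
  | VerifierState.reject => PMF.pure c

/-- The distribution of the configuration after `t` steps. -/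
noncomputable def run (V : PFAVerifier α) (P : V.Prover) (w : List α) : ℕ → PMF V.Config
  | 0 => PMF.pure V.initConfig
  | t + 1 => (V.run P w t).bind (V.step P w)

/-- The probability of ever being in the state `s`, for a halting state `s`: the probability of
being in `s` after `t` steps is then nondecreasing in `t`. -/
noncomputable def haltProb (V : PFAVerifier α) (P : V.Prover) (w : List α) (s : V.State) :
    ENNReal :=
  ⨆ t : ℕ, ((V.run P w t).map Config.state) s

/-- The probability that `V` accepts `w` when it communicates with `P`. -/
noncomputable def acceptProb (V : PFAVerifier α) (P : V.Prover) (w : List α) : ENNReal :=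
  V.haltProb P w VerifierState.accept

/-- The probability that `V` rejects `w` when it communicates with `P`. -/
noncomputable def rejectProb (V : PFAVerifier α) (P : V.Prover) (w : List α) : ENNReal :=
  V.haltProb P w VerifierState.reject

/-- `V` verifies the language `L` with error bound `ε`: an honest prover makes `V` accept every
member with probability at least `1 - ε`, and, whatever the prover is, every non-member is rejected
with probability at least `1 - ε`. -/
def Verifies (V : PFAVerifier α) (L : Language α) (ε : ℝ) : Prop :=
  (∃ P : V.Prover, ∀ w : List α, w ∈ L → ENNReal.ofReal (1 - ε) ≤ V.acceptProb P w) ∧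
  (∀ P : V.Prover, ∀ w : List α, w ∉ L → ENNReal.ofReal (1 - ε) ≤ V.rejectProb P w)

/-- `ρ` is a possible computation path of `V` on `w` with the prover `P`: each of its steps has
positive probability. -/
def IsPath (V : PFAVerifier α) (P : V.Prover) (w : List α) (ρ : ℕ → V.Config) : Prop :=
  ρ 0 = V.initConfig ∧ ∀ t : ℕ, ρ (t + 1) ∈ (V.step P w (ρ t)).support

/-- `V` is sweeping: the input head changes its direction only on the end-markers. In detail: on
any input, with any prover, on any computation path, if step `i` moves the head in one direction
and the next step `j` that moves the head moves it in the other direction, then the head is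
on an end-marker when it turns. -/
def IsSweeping (V : PFAVerifier α) : Prop :=
  ∀ (P : V.Prover) (w : List α) (ρ : ℕ → V.Config), V.IsPath P w ρ →
    ∀ i j : ℕ, i < j → (∀ l : ℕ, i < l → l ≤ j → (ρ l).pos = (ρ j).pos) →
      (((ρ i).pos < (ρ j).pos ∧ (ρ (j + 1)).pos < (ρ j).pos) ∨
        ((ρ j).pos < (ρ i).pos ∧ (ρ j).pos < (ρ (j + 1)).pos)) →
      (ρ j).pos = 0 ∨ (ρ j).pos = w.length + 1

/-- `V` runs in linear time: there is a constant `c` such that on every input of length `n`, with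
every prover, every computation path halts within `c * (n + 1)` steps. -/
def IsLinearTime (V : PFAVerifier α) : Prop :=
  ∃ c : ℕ, ∀ (P : V.Prover) (w : List α) (ρ : ℕ → V.Config), V.IsPath P w ρ →
    (ρ (c * (w.length + 1))).state = VerifierState.accept ∨
      (ρ (c * (w.length + 1))).state = VerifierState.reject

end PFAVerifier

/-- `L` is verified in linear time with bounded error by some sweeping PFA verifier. -/
def LinearTimeSweepingVerifiable {α : Type} (L : Language α) : Prop :=
  ∃ V : PFAVerifier α, V.IsSweeping ∧ V.IsLinearTime ∧ ∃ ε : ℝ, ε < 1 / 2 ∧ V.Verifies L ε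

/-- The word `0^m 1`; the letters `0` and `1` are `false` and `true`. -/
def zerosOne (m : ℕ) : List Bool := List.replicate m false ++ [true]

/-- The word `0^(2^0) 1 0^(2^1) 1 ⋯ 1 0^(2^(3k-1)) 1 1 (0^(2^(3k)) 1)^(2^(3k))`. -/
def dima2Word (k : ℕ) : List Bool :=
  (List.range (3 * k)).flatMap (fun i => zerosOne (2 ^ i)) ++ [true] ++
    (List.replicate (2 ^ (3 * k)) (zerosOne (2 ^ (3 * k)))).flatten

/-- The language `DIMA2`. -/
def DIMA2 : Language Bool := {w | ∃ k : ℕ, 0 < k ∧ w = dima2Word k}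

/-- `w` is the `k`-th shortest member of the language `L`: it is a member of `L`, and
exactly `k` members of `L` are at most as long as `w`. -/
def IsKthShortest {α : Type} (L : Language α) (k : ℕ) (w : List α) : Prop :=
  w ∈ L ∧ {v : List α | v ∈ L ∧ v.length ≤ w.length}.encard = k

/-- The language `DIMA2(I)` of the words that are the `k`-th shortest member of `DIMA2` for some
`k` in the set `I` of positive integers. -/
def DIMA2Sub (I : Set ℕ+) : Language Bool :=
  {w | ∃ k : ℕ+, k ∈ I ∧ IsKthShortest DIMA2 k w}

theorem dima2Word_length_strictMono : StrictMono fun k : ℕ => (dima2Word k).length := by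
  refine strictMono_nat_of_lt_succ fun k => ?_
  have h1 : 2 ^ (3 * k) < 2 ^ (3 * (k + 1)) := Nat.pow_lt_pow_right (by norm_num) (by omega)
  have h2 : 3 * (k + 1) = 3 * k + 1 + 1 + 1 := by ring
  simp only [dima2Word, zerosOne, List.length_append, List.length_flatMap, List.length_flatten,
    List.map_replicate, List.sum_replicate, List.length_replicate, List.length_singleton,
    smul_eq_mul]
  have h3 : ((List.range (3 * k)).map fun i => 2 ^ i + 1).sum ≤
      ((List.range (3 * (k + 1))).map fun i => 2 ^ i + 1).sum := by
    rw [h2]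
    simp only [List.range_succ, List.map_append, List.sum_append]
    omega
  have h4 : 2 ^ (3 * k) * (2 ^ (3 * k) + 1) < 2 ^ (3 * (k + 1)) * (2 ^ (3 * (k + 1)) + 1) :=
    Nat.mul_lt_mul'' h1 (by omega)
  omega

/-- The `k`-th shortest member of `DIMA2` is the displayed word with parameter `k`. -/
theorem isKthShortest_DIMA2_iff (k : ℕ) (hk : 0 < k) (w : List Bool) :
    IsKthShortest DIMA2 k w ↔ w = dima2Word k := by
  have key : ∀ m : ℕ, {v : List Bool | v ∈ DIMA2 ∧ v.length ≤ (dima2Word m).length}.encard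
      = m := by
    intro m
    have hset : {v : List Bool | v ∈ DIMA2 ∧ v.length ≤ (dima2Word m).length} =
        dima2Word '' (Finset.Icc 1 m : Finset ℕ) := by
      ext v
      constructor
      · rintro ⟨⟨j, hj, rfl⟩, hle⟩
        exact ⟨j, by simpa using ⟨hj, dima2Word_length_strictMono.le_iff_le.1 hle⟩, rfl⟩
      · rintro ⟨j, hj, rfl⟩
        have hj' : 1 ≤ j ∧ j ≤ m := by simpa using hj
        exact ⟨⟨j, hj'.1, rfl⟩, dima2Word_length_strictMono.le_iff_le.2 hj'.2⟩
    have hinj : Function.Injective dima2Word := fun a b h =>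
      dima2Word_length_strictMono.injective (congrArg List.length h)
    rw [hset, hinj.encard_image, Set.encard_coe_eq_coe_finsetCard]
    simp
  constructor
  · rintro ⟨⟨m, hm, rfl⟩, h⟩
    rw [key] at h
    rw [Nat.cast_inj.1 h]
  · rintro rfl
    exact ⟨⟨k, hk, rfl⟩, key k⟩

/-!
If the verifier's own symbols carry no information, then what it hears is an infinite message that
depends only on the prover and the input, and a single sweep over the input is enough. The verifier
chooses at random one of four tests, each of which compares this message with the input, or rejects
at once.

The message should be the input without the second letter of the separator `11`. Three deterministic
tests check that its block lengths are those of the input, that each block up to the separator is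
half as long as its successor, while the blocks after the separator are as long as theirs, and that
the length of the first block after the separator is the number of these blocks. A message that
passes them all exists only for the words `dima2Word k`.

The fourth test tosses a coin `m (m + 1)` times, where `m = 8 ^ k`, and counts the blocks of length
`m` that end among as many symbols of the message as there are heads. By Chebyshev's inequality
their number agrees up to one with the integer part of `8 ^ k` times the bias of the coin, with
probability at least `3 / 4`. Modulo `8` this integer part is the `k`-th octal digit of the bias,
which can encode whether `k ∈ I`.
-/

/-! ### Verifiers that listen to a message -/

namespace PFAVerifier

variable {α : Type} (V : PFAVerifier α) (P : V.Prover) (w : List α)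

theorem isSweeping_of_left_notMem
    (h : ∀ r a s, (s, HeadMove.left) ∉ (V.readStep r a).support) : V.IsSweeping := by
  have hstep : ∀ P w c, ∀ c' ∈ (V.step P w c).support, c.pos ≤ c'.pos := by
    rintro P w ⟨r | q | _ | _, p, l⟩ c' hc'
    · obtain ⟨⟨s, d⟩, hx, rfl⟩ := (PMF.mem_support_map_iff _ _ _).1 hc'
      cases d with
      | left => exact absurd hx (h _ _ _)
      | stay => exact le_rfl
      | right => exact p.le_succ
    all_goals
      obtain rfl := (PMF.mem_support_pure_iff _ _).1 hc'
      rfl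
  intro P w ρ hρ i j hij _ hturn
  have hmono : Monotone fun t => (ρ t).pos :=
    monotone_nat_of_le_succ fun t => hstep P w (ρ t) _ (hρ.2 t)
  have hi : (ρ i).pos ≤ (ρ j).pos := hmono hij.le
  have hj : (ρ j).pos ≤ (ρ (j + 1)).pos := hmono j.le_succ
  omega

/-- The distribution of the configuration `t` steps after the configuration `c`. It unfolds the
first step, whereas `PFAVerifier.run` unfolds the last one. -/
noncomputable def runFrom : ℕ → V.Config → PMF V.Config
  | 0, c => PMF.pure c
  | t + 1, c => (V.step P w c).bind (runFrom t)

theorem run_bind_runFrom (s t : ℕ) : (V.run P w s).bind (V.runFrom P w t) = V.run P w (s + t) := by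
  induction t generalizing s with
  | zero => exact PMF.bind_pure _
  | succ t ih =>
    calc (V.run P w s).bind (V.runFrom P w (t + 1))
        = (V.run P w (s + 1)).bind (V.runFrom P w t) := (PMF.bind_bind _ _ _).symm
      _ = V.run P w (s + (t + 1)) := by rw [ih, Nat.add_right_comm, Nat.add_assoc]

theorem run_eq_runFrom (t : ℕ) : V.run P w t = V.runFrom P w t V.initConfig := by
  rw [← Nat.zero_add t, ← run_bind_runFrom, Nat.zero_add]
  exact PMF.pure_bind _ _

/-- The halting state of a computation with the given verdict: `true` means acceptance. -/
def verdict {R C : Type} : Bool → VerifierState R C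
  | true => .accept
  | false => .reject

variable {V P w}

theorem runFrom_verdict (b : Bool) (p : ℕ) (l : List V.Msg) (t : ℕ) :
    V.runFrom P w t ⟨verdict b, p, l⟩ = PMF.pure ⟨verdict b, p, l⟩ := by
  induction t with
  | zero => rfl
  | succ t ih => cases b <;> exact (PMF.pure_bind _ _).trans ih

theorem IsPath.mem_support_run {ρ : ℕ → V.Config} (hρ : V.IsPath P w ρ) (t : ℕ) :
    ρ t ∈ (V.run P w t).support := by
  induction t with
  | zero => exact (PMF.mem_support_pure_iff _ _).2 hρ.1
  | succ t ih => exact (PMF.mem_support_bind_iff _ _ _).2 ⟨ρ t, ih, hρ.2 t⟩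

end PFAVerifier

theorem tapeCell_append_cons {α : Type} (u : List α) (a : α) (v : List α) :
    tapeCell (u ++ a :: v) (u.length + 1) = .sym a := by
  simp [tapeCell]

theorem tapeCell_length_succ {α : Type} (u : List α) : tapeCell u (u.length + 1) = .rightEnd := by
  simp [tapeCell]

/-- A one-way probabilistic finite automaton that reads a word over `α` and then the right
end-marker while it listens to an infinite message over `β`. Such a
message is what the prover of a verifier whose own symbols carry no information amounts to. -/
structure StreamVerifier (α β : Type) : Type 1 where
  State : Type
  finite_state : Finite State
  /-- the distribution of the state in which the first letter is read -/
  start : PMF State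
  /-- what happens on a letter, or on the right end-marker `none`: `Sum.inl` gives the next state,
  `Sum.inr` asks for the next symbol of the message and chooses the next state accordingly -/
  next : State → Option α → PMF (State ⊕ (β → State))
  /-- the verdict in the state reached after the right end-marker -/
  accept : State → Bool

namespace StreamVerifier

open PFAVerifier (verdict)

variable {α β : Type}

/-- The state reached by a transition, and the rest of the message, when the message is `y`. -/
def settle {σ : Type} (y : Stream' β) : σ ⊕ (β → σ) → σ × Stream' β
  | .inl q => (q, y)
  | .inr f => (f y.head, y.tail)

/-- The distribution of the verdict, from the state `q`, with message `y`. -/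
noncomputable def outcomeFrom (M : StreamVerifier α β) (q : M.State) (y : Stream' β) :
    List α → PMF Bool
  | [] => (M.next q none).map fun x => M.accept (settle y x).1
  | a :: w => (M.next q (some a)).bind fun x => outcomeFrom M (settle y x).1 (settle y x).2 w

/-- The distribution of the verdict on the word `w` with message `y`. -/
noncomputable def outcome (M : StreamVerifier α β) (y : Stream' β) (w : List α) : PMF Bool :=
  M.start.bind fun q => M.outcomeFrom q y w

section Simulation

variable {σ : Type}

/-- The state of the simulating verifier in a state of the simulated one or with its verdict. -/
def toVerifierState : σ ⊕ Bool → VerifierState (Option σ) (β → σ ⊕ Bool)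
  | .inl q => .read (some q)
  | .inr b => verdict b

/-- The state of the simulating verifier right after a transition of the simulated one, where `g`
tells how to go on from the state that is reached. -/
def afterTransition (g : σ → σ ⊕ Bool) : σ ⊕ (β → σ) → VerifierState (Option σ) (β → σ ⊕ Bool)
  | .inl q => toVerifierState (g q)
  | .inr f => .comm (g ∘ f)

variable (M : StreamVerifier α β)

/-- The transitions of the simulating verifier in its reading states: `none` is the initial state,
which reads the left end-marker. -/
noncomputable def readStep : Option M.State → TapeSymbol α →
    PMF (VerifierState (Option M.State) (β → M.State ⊕ Bool) × HeadMove)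
  | none, .leftEnd => M.start.map fun q => (.read (some q), .right)
  | some q, .sym a => (M.next q (some a)).map fun x => (afterTransition Sum.inl x, .right)
  | some q, .rightEnd =>
    (M.next q none).map fun x => (afterTransition (Sum.inr ∘ M.accept) x, .stay)
  | _, _ => PMF.pure (.reject, .stay)

theorem left_notMem_support_readStep (r : Option M.State) (a : TapeSymbol α)
    (s : VerifierState (Option M.State) (β → M.State ⊕ Bool)) :
    (s, HeadMove.left) ∉ (M.readStep r a).support := by
  rcases r with _ | q <;> rcases a with _ | _ | a <;> simp [readStep]

variable [Finite β] [Inhabited β]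

/-- The two-way verifier that simulates `M`. It sends the symbol `default` whenever it asks for the
next symbol of the message. -/
noncomputable def toPFAVerifier : PFAVerifier α where
  ReadState := Option M.State
  CommState := β → M.State ⊕ Bool
  Msg := β
  finite_readState := by have := M.finite_state; infer_instance
  finite_commState := by have := M.finite_state; infer_instance
  finite_msg := inferInstance
  nonempty_msg := inferInstance
  init := none
  readStep := M.readStep
  send _ := default
  receive f b := toVerifierState (f b)
  not_left_of_leftEnd r := M.left_notMem_support_readStep r _
  not_right_of_rightEnd := by rintro (_ | q) s <;> simp [readStep]

/-- The message that the prover `P` gives on the input `w`. -/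
def message (P : M.toPFAVerifier.Prover) (w : List α) : Stream' β :=
  fun n => P w (List.replicate (n + 1) (default : β))

variable {P : M.toPFAVerifier.Prover} {w : List α}

/-- The configuration of the simulating verifier after it has received `j` symbols. -/
def config (s : M.toPFAVerifier.State) (p j : ℕ) : M.toPFAVerifier.Config :=
  ⟨s, p, List.replicate j (default : β)⟩

theorem map_state_runFrom_afterTransition {g : M.State → M.State ⊕ Bool} {p T : ℕ}
    {F : M.State → Stream' β → PMF M.toPFAVerifier.State}
    (hF : ∀ q, ∀ j, ∀ t ≥ T, (M.toPFAVerifier.runFrom P w t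
      (M.config (toVerifierState (g q)) p j)).map PFAVerifier.Config.state =
        F q ((M.message P w).drop j))
    (x : M.State ⊕ (β → M.State)) (j : ℕ) {t : ℕ} (ht : T + 1 ≤ t) :
    (M.toPFAVerifier.runFrom P w t (M.config (afterTransition g x) p j)).map
        PFAVerifier.Config.state =
      F (settle ((M.message P w).drop j) x).1 (settle ((M.message P w).drop j) x).2 := by
  rcases x with q | f
  · exact hF q j t (by omega)
  · obtain ⟨t, rfl⟩ := Nat.exists_eq_add_of_le' (by omega : 1 ≤ t)
    have hstep : M.toPFAVerifier.step P w (M.config (afterTransition g (.inr f)) p j) =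
        PMF.pure (M.config (toVerifierState (g (f ((M.message P w).get j)))) p (j + 1)) := rfl
    rw [PFAVerifier.runFrom, hstep, PMF.pure_bind, hF _ (j + 1) t (by omega), settle,
      Stream'.head_drop, Stream'.tail_drop']

theorem step_sym {p : ℕ} {a : α} (h : tapeCell w p = .sym a) (q : M.State) (j : ℕ) :
    M.toPFAVerifier.step P w (M.config (.read (some q)) p j) =
      (M.next q (some a)).map fun x => M.config (afterTransition Sum.inl x) (p + 1) j := by
  simp only [PFAVerifier.step, config, h]
  exact PMF.map_comp _ _ _

theorem step_rightEnd {p : ℕ} (h : tapeCell w p = .rightEnd) (q : M.State) (j : ℕ) :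
    M.toPFAVerifier.step P w (M.config (.read (some q)) p j) =
      (M.next q none).map fun x => M.config (afterTransition (Sum.inr ∘ M.accept) x) p j := by
  simp only [PFAVerifier.step, config, h]
  exact PMF.map_comp _ _ _

theorem map_state_runFrom (q : M.State) (u v : List α) (j : ℕ) {t : ℕ}
    (ht : 2 * v.length + 2 ≤ t) :
    (M.toPFAVerifier.runFrom P (u ++ v) t (M.config (.read (some q)) (u.length + 1) j)).map
        PFAVerifier.Config.state =
      (M.outcomeFrom q ((M.message P (u ++ v)).drop j) v).map verdict := by
  induction v generalizing q u j t with
  | nil =>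
    obtain ⟨t, rfl⟩ := Nat.exists_eq_add_of_le' (by omega : 1 ≤ t)
    rw [List.append_nil, PFAVerifier.runFrom, step_rightEnd _ (tapeCell_length_succ u),
      PMF.bind_map, PMF.map_bind, outcomeFrom, PMF.map_comp]
    refine congrArg _ (funext fun x => ?_)
    refine M.map_state_runFrom_afterTransition (F := fun q _ => PMF.pure (verdict (M.accept q)))
      (T := 0) (fun q j t _ => ?_) x j (Nat.le_of_succ_le_succ ht)
    exact (congrArg _ (PFAVerifier.runFrom_verdict _ _ _ _)).trans (PMF.pure_map _ _)
  | cons a v ih =>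
    obtain ⟨t, rfl⟩ := Nat.exists_eq_add_of_le' (by omega : 1 ≤ t)
    rw [PFAVerifier.runFrom, step_sym _ (tapeCell_append_cons u a v), PMF.bind_map, PMF.map_bind,
      outcomeFrom, PMF.map_bind]
    refine congrArg _ (funext fun x => ?_)
    refine M.map_state_runFrom_afterTransition
      (F := fun q y => (M.outcomeFrom q y v).map verdict) (T := 2 * v.length + 2)
      (fun q j t ht => ?_) x j (by rw [List.length_cons] at ht; omega)
    have h := ih q (u ++ [a]) j ht
    rw [← List.append_cons, List.length_append] at h
    exact h

theorem map_state_run (P : M.toPFAVerifier.Prover) (w : List α) {t : ℕ}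
    (ht : 2 * w.length + 3 ≤ t) :
    (M.toPFAVerifier.run P w t).map PFAVerifier.Config.state =
      (M.outcome (M.message P w) w).map verdict := by
  obtain ⟨t, rfl⟩ := Nat.exists_eq_add_of_le' (by omega : 1 ≤ t)
  have hstep : M.toPFAVerifier.step P w M.toPFAVerifier.initConfig =
      M.start.map fun q => M.config (.read (some q)) 1 0 := PMF.map_comp _ _ _
  rw [PFAVerifier.run_eq_runFrom, PFAVerifier.runFrom, hstep, PMF.bind_map, PMF.map_bind, outcome,
    PMF.map_bind]
  exact congrArg _ (funext fun q => M.map_state_runFrom q [] w 0 (by omega))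

theorem isSweeping_toPFAVerifier : M.toPFAVerifier.IsSweeping :=
  PFAVerifier.isSweeping_of_left_notMem _ M.left_notMem_support_readStep

theorem isLinearTime_toPFAVerifier : M.toPFAVerifier.IsLinearTime := by
  refine ⟨3, fun P w ρ hρ => ?_⟩
  have h := (PMF.mem_support_map_iff PFAVerifier.Config.state _ _).2
    ⟨_, hρ.mem_support_run (3 * (w.length + 1)), rfl⟩
  rw [map_state_run M P w (by omega)] at h
  obtain ⟨b, -, hb⟩ := (PMF.mem_support_map_iff _ _ _).1 h
  cases b <;> simp [← hb, verdict]

theorem outcome_le_haltProb (P : M.toPFAVerifier.Prover) (w : List α) (b : Bool) :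
    M.outcome (M.message P w) w b ≤ M.toPFAVerifier.haltProb P w (verdict b) := by
  refine le_iSup_of_le (2 * w.length + 3) ?_
  rw [map_state_run M P w le_rfl, PMF.map_apply]
  exact le_of_eq_of_le (by simp) (ENNReal.le_tsum b)

end Simulation

theorem linearTimeSweepingVerifiable [Finite β] [Nonempty β] (M : StreamVerifier α β)
    {L : Language α} {ε : ℝ} (hε : ε < 1 / 2)
    (complete : ∀ w ∈ L, ∃ y, 1 - ε ≤ (M.outcome y w true).toReal)
    (sound : ∀ w ∉ L, ∀ y, 1 - ε ≤ (M.outcome y w false).toReal) :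
    LinearTimeSweepingVerifiable L := by
  inhabit β
  choose! y hy using complete
  refine ⟨M.toPFAVerifier, M.isSweeping_toPFAVerifier, M.isLinearTime_toPFAVerifier, ε, hε,
    ⟨fun w l => (y w).get (l.length - 1), fun w hw => ?_⟩, fun P w hw => ?_⟩
  · refine (ENNReal.ofReal_le_of_le_toReal ?_).trans (M.outcome_le_haltProb _ w true)
    have hmessage : M.message (fun w (l : List β) => (y w).get (l.length - 1)) w = y w := by
      funext n
      exact congrArg (y w).get (Nat.add_sub_cancel n 1 ▸ congrArg (· - 1) List.length_replicate)
    exact hmessage ▸ hy w hw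
  · exact (ENNReal.ofReal_le_of_le_toReal (sound w hw _)).trans (M.outcome_le_haltProb P w false)

end StreamVerifier

/-! ### Random choice of a test -/

theorem toReal_bind_apply {κ γ : Type} [Fintype κ] (p : PMF κ) (f : κ → PMF γ) (c : γ) :
    (p.bind f c).toReal = ∑ k, (p k).toReal * (f k c).toReal := by
  rw [PMF.bind_apply, tsum_fintype, ENNReal.toReal_sum fun k _ => ENNReal.mul_ne_top
    (PMF.apply_ne_top _ _) (PMF.apply_ne_top _ _)]
  simp only [ENNReal.toReal_mul]

namespace StreamVerifier

variable {α β : Type}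

theorem settle_map {σ τ : Type} (g : σ → τ) (y : Stream' β) (x : σ ⊕ (β → σ)) :
    settle y (Sum.map g (g ∘ ·) x) = Prod.map g id (settle y x) := by
  cases x <;> rfl

theorem outcomeFrom_map {M N : StreamVerifier α β} (g : M.State → N.State)
    (hnext : ∀ q a, N.next (g q) a = (M.next q a).map (Sum.map g (g ∘ ·)))
    (haccept : ∀ q, N.accept (g q) = M.accept q) (q : M.State) (y : Stream' β) (w : List α) :
    N.outcomeFrom (g q) y w = M.outcomeFrom q y w := by
  induction w generalizing q y with
  | nil =>
    simp only [outcomeFrom, hnext, PMF.map_comp, Function.comp_def, ← haccept]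
    refine congrArg (PMF.map · _) (funext fun x => ?_)
    exact congrArg (fun z => N.accept z.1) (settle_map g y x)
  | cons a w ih =>
    simp only [outcomeFrom, hnext, PMF.bind_map, ← ih]
    refine congrArg _ (funext fun x => ?_)
    exact congrArg (fun z => N.outcomeFrom z.1 z.2 w) (settle_map g y x)

section Mixture

variable {ι : Type} [Finite ι] (μ : PMF ι) (M : ι → StreamVerifier α β)

/-- The verifier that draws `i` from `μ` and then works as `M i`. -/
noncomputable def mixture : StreamVerifier α β where
  State := Σ i, (M i).State
  finite_state := by have := fun i => (M i).finite_state; infer_instance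
  start := μ.bind fun i => (M i).start.map (Sigma.mk i)
  next q a := ((M q.1).next q.2 a).map (Sum.map (Sigma.mk q.1) (Sigma.mk q.1 ∘ ·))
  accept q := (M q.1).accept q.2

theorem outcome_mixture (y : Stream' β) (w : List α) :
    (mixture μ M).outcome y w = μ.bind fun i => (M i).outcome y w := by
  refine (PMF.bind_bind _ _ _).trans (congrArg _ (funext fun i => ?_))
  refine (PMF.bind_map _ _ _).trans (congrArg _ (funext fun q => ?_))
  let g (q : (M i).State) : (mixture μ M).State := (⟨i, q⟩ : Σ i, (M i).State)
  exact outcomeFrom_map g (fun _ _ => rfl) (fun _ => rfl) q y w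

end Mixture

/-- The verifier that rejects whatever it reads and hears. -/
noncomputable def rejecting : StreamVerifier α β where
  State := Unit
  finite_state := inferInstance
  start := PMF.pure ()
  next _ _ := PMF.pure (.inl ())
  accept _ := false

theorem outcome_rejecting (y : Stream' β) (w : List α) :
    (rejecting : StreamVerifier α β).outcome y w = PMF.pure false := by
  refine (PMF.pure_bind _ _).trans ?_
  induction w generalizing y with
  | nil => exact PMF.pure_map _ _
  | cons _ w ih => exact (PMF.pure_bind _ _).trans (ih y)

-- The `card ι - 1` rejecting verifiers make acceptance more probable than rejection only if all of
-- the `M i` tend to accept.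
theorem toReal_outcome_mixture_rejecting {ι : Type} [Fintype ι] [Nonempty ι]
    (M : ι → StreamVerifier α β) (y : Stream' β) (w : List α) (b : Bool) :
    ((mixture (PMF.uniformOfFintype _)
      (Sum.elim M fun _ : Fin (Fintype.card ι - 1) => rejecting)).outcome y w b).toReal =
      (∑ i, ((M i).outcome y w b).toReal + (Fintype.card ι - 1) * (PMF.pure false b).toReal) /
        (2 * Fintype.card ι - 1) := by
  have hpred : ((Fintype.card ι - 1 : ℕ) : ℝ) = Fintype.card ι - 1 :=
    Nat.cast_pred Fintype.card_pos
  have hcard :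
      (Fintype.card (ι ⊕ Fin (Fintype.card ι - 1)) : ℝ) = 2 * Fintype.card ι - 1 := by
    rw [Fintype.card_sum, Fintype.card_fin, Nat.cast_add, hpred]
    ring
  rw [outcome_mixture, toReal_bind_apply, Fintype.sum_sum_type]
  simp only [PMF.uniformOfFintype_apply, ENNReal.toReal_inv, ENNReal.toReal_natCast, hcard,
    Sum.elim_inl, Sum.elim_inr, outcome_rejecting, Finset.sum_const, Finset.card_univ,
    Fintype.card_fin, nsmul_eq_mul, hpred, ← Finset.mul_sum]
  ring

theorem linearTimeSweepingVerifiable_of_tests {ι : Type} [Fintype ι] [Nonempty ι] [Finite β]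
    [Nonempty β] (M : ι → StreamVerifier α β) {L : Language α} {δ : ι → ℝ} (hδ : 0 ≤ δ)
    (hsum : ∑ i, δ i < 1 / 2)
    (complete : ∀ w ∈ L, ∃ y, ∀ i, 1 - δ i ≤ ((M i).outcome y w true).toReal)
    (sound : ∀ w ∉ L, ∀ y, ∃ i, 1 - δ i ≤ ((M i).outcome y w false).toReal) :
    LinearTimeSweepingVerifiable L := by
  set n := Fintype.card ι
  have hn : (1 : ℝ) ≤ n := Nat.one_le_cast.2 Fintype.card_pos
  refine (mixture (PMF.uniformOfFintype _)
    (Sum.elim M fun _ : Fin (n - 1) => rejecting)).linearTimeSweepingVerifiable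
    (ε := 1 - (n - ∑ i, δ i) / (2 * n - 1)) ?_ (fun w hw => ?_) fun w hw y => ?_
  · have : 1 / 2 < (n - ∑ i, δ i) / (2 * n - 1) := by
      rw [lt_div_iff₀ (by linarith)]
      linarith
    linarith
  · obtain ⟨y, hy⟩ := complete w hw
    refine ⟨y, ?_⟩
    rw [toReal_outcome_mixture_rejecting, sub_sub_cancel]
    gcongr
    · linarith
    · simpa [n] using Finset.sum_le_sum fun i (_ : i ∈ Finset.univ) => hy i
  · obtain ⟨i, hi⟩ := sound w hw y
    rw [toReal_outcome_mixture_rejecting, sub_sub_cancel]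
    gcongr
    · linarith
    · have hδi : δ i ≤ ∑ i, δ i := Finset.single_le_sum (fun i _ => hδ i) (Finset.mem_univ i)
      have hreject :
          ((M i).outcome y w false).toReal ≤ ∑ i, ((M i).outcome y w false).toReal :=
        Finset.single_le_sum (f := fun i => ((M i).outcome y w false).toReal)
          (fun i _ => ENNReal.toReal_nonneg) (Finset.mem_univ i)
      simp only [PMF.pure_apply, if_true, ENNReal.toReal_one, mul_one]
      linarith

end StreamVerifier

/-! ### Deterministic tests -/

/-- The infinite message `y` starts with the word `l`. -/
def StartsWith {β : Type} (y : Stream' β) (l : List β) : Prop := y.take l.length = l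

namespace StartsWith

variable {β : Type} {y : Stream' β} {l l' : List β}

theorem nil : StartsWith y [] := rfl

theorem cons_iff {b : β} : StartsWith y (b :: l) ↔ y.head = b ∧ StartsWith y.tail l := by
  simp [StartsWith, Stream'.take_succ]

theorem take_eq (h : StartsWith y l) {n : ℕ} (hn : n ≤ l.length) : y.take n = l.take n := by
  rw [← h, Stream'.take_take, Nat.min_eq_right hn]

theorem of_prefix (h : StartsWith y l') (hl : l <+: l') : StartsWith y l :=
  (h.take_eq hl.length_le).trans (List.prefix_iff_eq_take.1 hl).symm

theorem prefix_of_length_le (h : StartsWith y l) (h' : StartsWith y l')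
    (hl : l.length ≤ l'.length) : l <+: l' :=
  List.prefix_iff_eq_take.2 (h.symm.trans (h'.take_eq hl))

theorem drop (h : StartsWith y (l ++ l')) : StartsWith (y.drop l.length) l' := by
  induction l generalizing y with
  | nil => exact h
  | cons a l ih => exact ih (cons_iff.1 h).2

theorem append_stream (l : List β) (z : Stream' β) : StartsWith (l ++ₛ z) l := by
  rw [StartsWith, Stream'.take_append_of_le_length _ _ _ le_rfl, List.take_length]

end StartsWith

/-- A deterministic finite automaton that compares a message with the input: in each state, for
each letter and for the end `none` of the input, it may expect a certain next symbol of the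
message. -/
structure MessageTest (α β σ : Type) extends DFA α σ where
  /-- the expected symbol, or `none` if the message is not consulted -/
  expected : σ → Option α → Option β

namespace MessageTest

variable {α β σ : Type} (T : MessageTest α β σ)

/-- The word that is expected while `w` is read from the state `q`. -/
def emit (q : σ) : List α → List β
  | [] => []
  | a :: w => (T.expected q (some a)).toList ++ emit (T.step q a) w

/-- The word that the message has to start with when the rest of the input, to be read from the
state `q`, is `w`. -/
def transcriptFrom (q : σ) (w : List α) : List β :=
  T.emit q w ++ (T.expected (T.evalFrom q w) none).toList

theorem transcriptFrom_nil (q : σ) : T.transcriptFrom q [] = (T.expected q none).toList := rfl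

theorem transcriptFrom_cons (q : σ) (a : α) (w : List α) : T.transcriptFrom q (a :: w) =
    (T.expected q (some a)).toList ++ T.transcriptFrom (T.step q a) w :=
  List.append_assoc _ _ _

/-- The word that the message has to start with when the input is `w`. -/
def transcript (w : List α) : List β := T.transcriptFrom T.start w

theorem emit_append (q : σ) (u v : List α) :
    T.emit q (u ++ v) = T.emit q u ++ T.emit (T.evalFrom q u) v := by
  induction u generalizing q with
  | nil => rfl
  | cons a u ih => simp [emit, ih]

variable [Finite σ]

open Classical in
/-- The verifier that accepts the inputs that `T` accepts as a finite automaton, if all its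
expectations about the message are fulfilled. The state `none` records a disappointment. -/
noncomputable def toStreamVerifier : StreamVerifier α β where
  State := Option σ
  finite_state := inferInstance
  start := PMF.pure (some T.start)
  next
    | none, _ => PMF.pure (.inl none)
    | some q, a =>
      let q' := a.elim q (T.step q)
      PMF.pure ((T.expected q a).elim (.inl (some q')) fun b =>
        .inr fun b' => if b' = b then some q' else none)
  accept q := decide (∃ s ∈ T.accept, q = some s)

theorem outcomeFrom_none (y : Stream' β) (w : List α) :
    T.toStreamVerifier.outcomeFrom (none : Option σ) y w = PMF.pure false := by
  induction w generalizing y with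
  | nil => exact (PMF.pure_map _ _).trans (by simp [toStreamVerifier, StreamVerifier.settle])
  | cons _ w ih => exact (PMF.pure_bind _ _).trans (ih y)

open Classical in
theorem outcomeFrom_some (q : σ) (y : Stream' β) (w : List α) :
    T.toStreamVerifier.outcomeFrom (some q) y w =
      PMF.pure (decide (T.evalFrom q w ∈ T.accept ∧ StartsWith y (T.transcriptFrom q w))) := by
  induction w generalizing q y with
  | nil =>
    refine (PMF.pure_map _ _).trans ?_
    rcases h : T.expected q none with _ | b
    · simp [h, transcriptFrom_nil, StreamVerifier.settle, toStreamVerifier, StartsWith.nil]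
    · by_cases hb : y.head = b <;> simp [h, transcriptFrom_nil, StreamVerifier.settle,
        toStreamVerifier, StartsWith.nil, StartsWith.cons_iff, hb]
  | cons a w ih =>
    refine (PMF.pure_bind _ _).trans ?_
    rcases h : T.expected q (some a) with _ | b
    · simpa [h, transcriptFrom_cons, StreamVerifier.settle] using ih (T.step q a) y
    · by_cases hb : y.head = b
      · simpa [h, transcriptFrom_cons, StreamVerifier.settle, StartsWith.cons_iff, hb]
          using ih (T.step q a) y.tail
      · simpa [h, transcriptFrom_cons, StreamVerifier.settle, StartsWith.cons_iff, hb]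
          using T.outcomeFrom_none y.tail w

open Classical in
theorem outcome_toStreamVerifier (y : Stream' β) (w : List α) :
    T.toStreamVerifier.outcome y w =
      PMF.pure (decide (w ∈ T.accepts ∧ StartsWith y (T.transcript w))) :=
  (PMF.pure_bind _ _).trans (T.outcomeFrom_some T.start y w)

end MessageTest

/-! ### Block lengths -/

/-- The word `0^(l₀) 1 0^(l₁) 1 ⋯` for the list `l = [l₀, l₁, …]`. -/
def blocks (l : List ℕ) : List Bool := l.flatMap zerosOne

theorem zerosOne_zero : zerosOne 0 = [true] := rfl

theorem zerosOne_succ (m : ℕ) : zerosOne (m + 1) = false :: zerosOne m := rfl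

theorem length_zerosOne (m : ℕ) : (zerosOne m).length = m + 1 := by simp [zerosOne]

theorem blocks_cons (m : ℕ) (l : List ℕ) : blocks (m :: l) = zerosOne m ++ blocks l := rfl

theorem blocks_append (l l' : List ℕ) : blocks (l ++ l') = blocks l ++ blocks l' :=
  List.flatMap_append

theorem length_blocks (l : List ℕ) : (blocks l).length = l.sum + l.length := by
  induction l with
  | nil => rfl
  | cons m l ih =>
    rw [blocks_cons, List.length_append, length_zerosOne, ih, List.sum_cons, List.length_cons]
    omega

theorem zerosOne_append_prefix {m n : ℕ} {u v : List Bool}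
    (h : zerosOne m ++ u <+: zerosOne n ++ v) : m = n ∧ u <+: v := by
  induction m generalizing n with
  | zero => cases n <;> simp_all [zerosOne_zero, zerosOne_succ]
  | succ m ih =>
    cases n with
    | zero => simp [zerosOne_zero, zerosOne_succ] at h
    | succ n => simpa using ih (List.cons_prefix_cons.1 h).2

theorem blocks_prefix_blocks {l l' : List ℕ} : blocks l <+: blocks l' ↔ l <+: l' := by
  constructor
  · intro h
    induction l generalizing l' with
    | nil => exact List.nil_prefix
    | cons m l ih =>
      cases l' with
      | nil => simp [blocks, zerosOne] at h
      | cons n l' =>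
        obtain ⟨rfl, hl⟩ := zerosOne_append_prefix h
        exact (List.prefix_cons_inj m).2 (ih hl)
  · rintro ⟨l, rfl⟩
    exact ⟨blocks l, (blocks_append _ _).symm⟩

theorem eq_of_startsWith_blocks {y : Stream' Bool} {l s t : List ℕ} {m n : ℕ}
    (h : StartsWith y (blocks (l ++ m :: s))) (h' : StartsWith y (blocks (l ++ n :: t))) :
    m = n := by
  wlog hle : (blocks (l ++ m :: s)).length ≤ (blocks (l ++ n :: t)).length generalizing m n s t
  · exact (this h' h (le_of_not_ge hle)).symm
  have hprefix := blocks_prefix_blocks.1 (h.prefix_of_length_le h' hle)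
  exact (List.cons_prefix_cons.1 ((List.prefix_append_right_inj l).1 hprefix)).1

theorem exists_blocks_eq_append_true (w : List Bool) : ∃ l, blocks l = w ++ [true] := by
  induction w with
  | nil => exact ⟨[0], rfl⟩
  | cons a w ih =>
    obtain ⟨l, hl⟩ := ih
    rcases a with _ | _
    · rcases l with _ | ⟨m, l⟩
      · simp [blocks] at hl
      · exact ⟨(m + 1) :: l, congrArg (false :: ·) hl⟩
    · exact ⟨0 :: l, congrArg (true :: ·) hl⟩

/-- The block lengths of the words `0 1 0^(2a₁) 1 ⋯ 0^(2aⱼ) 1 1 0^(2c) 1 0^(c₁) 1 ⋯ 0^(cᵣ) 1`: the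
block of length `0` is the second letter of the separator `11`. -/
def layout (as : List ℕ) (c : ℕ) (cs : List ℕ) : List ℕ :=
  1 :: as.map (2 * ·) ++ 0 :: 2 * c :: cs

theorem blocks_layout (as : List ℕ) (c : ℕ) (cs : List ℕ) :
    blocks (layout as c cs) = zerosOne 1 ++ blocks (as.map (2 * ·)) ++ [true] ++
      zerosOne (2 * c) ++ blocks cs := by
  simp [layout, blocks_cons, blocks_append, zerosOne_zero]

/-- The list `[1, 2, …, 2 ^ (n - 1)]`. -/
def twoPowers (n : ℕ) : List ℕ := (List.range n).map (2 ^ ·)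

theorem length_twoPowers (n : ℕ) : (twoPowers n).length = n := by simp [twoPowers]

theorem pos_of_mem_twoPowers {n a : ℕ} (h : a ∈ twoPowers n) : 0 < a := by
  obtain ⟨i, -, rfl⟩ := List.mem_map.1 h
  positivity

theorem twoPowers_succ (n : ℕ) : twoPowers (n + 1) = 1 :: (twoPowers n).map (2 * ·) := by
  simp [twoPowers, List.range_succ_eq_map, pow_succ', Function.comp_def]

theorem replicate_two_pow_succ (n r : ℕ) :
    List.replicate (2 ^ n) r = r :: List.replicate (2 ^ n - 1) r := by
  rw [← List.replicate_succ, Nat.sub_add_cancel Nat.one_le_two_pow]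

theorem dima2Word_eq_blocks (k : ℕ) : dima2Word k =
    blocks (twoPowers (3 * k) ++ 0 :: List.replicate (2 ^ (3 * k)) (2 ^ (3 * k))) := by
  rw [dima2Word, blocks_append, blocks_cons, zerosOne_zero, blocks, twoPowers, List.flatMap_map,
    List.append_assoc, blocks, List.flatMap_replicate]

theorem dima2Word_eq_blocks_layout {k j : ℕ} (h : 3 * k = j + 1) :
    dima2Word k = blocks (layout (twoPowers j) (2 ^ j)
      (List.replicate (2 ^ (j + 1) - 1) (2 ^ (j + 1)))) := by
  rw [dima2Word_eq_blocks, h, layout, ← twoPowers_succ, ← pow_succ', ← replicate_two_pow_succ]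

/-- The message that an honest prover sends to convince the verifier that the input is
`dima2Word k`: this word without the second letter of the separator `11`. -/
def dima2Message (k : ℕ) : List Bool :=
  blocks (twoPowers (3 * k) ++ List.replicate (2 ^ (3 * k)) (2 ^ (3 * k)))

theorem dima2Message_eq_blocks {k j : ℕ} (h : 3 * k = j + 1) :
    dima2Message k = blocks (1 :: (twoPowers j).map (2 * ·) ++
      2 * 2 ^ j :: List.replicate (2 ^ (j + 1) - 1) (2 ^ (j + 1))) := by
  rw [dima2Message, h, ← twoPowers_succ, ← pow_succ', ← replicate_two_pow_succ]

theorem prefix_cons_self_iff {γ : Type} {x : γ} {l : List γ} :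
    l <+: x :: l ↔ l = List.replicate l.length x := by
  induction l with
  | nil => simp
  | cons a l ih =>
    rw [List.cons_prefix_cons, List.length_cons, List.replicate_succ, List.cons.injEq]
    exact and_congr_right fun h => h ▸ ih

theorem append_cons_prefix_map_two_mul_iff {as cs : List ℕ} {b c : ℕ} :
    as ++ c :: cs <+: b :: as.map (2 * ·) ++ 2 * c :: cs ↔
      as = (twoPowers as.length).map (· * b) ∧ c = 2 ^ as.length * b ∧
        cs = List.replicate cs.length (2 * c) := by
  induction as generalizing b with
  | nil => simp [twoPowers, List.cons_prefix_cons, prefix_cons_self_iff]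
  | cons a as ih =>
    rw [List.cons_append, List.cons_append, List.cons_prefix_cons, List.map_cons, ih,
      List.length_cons, twoPowers_succ, List.map_cons, List.map_map, List.cons.injEq, one_mul,
      and_assoc]
    refine and_congr_right fun h => ?_
    simp only [h, Function.comp_def, pow_succ, mul_assoc, mul_left_comm 2]

/-! ### The format of the input -/

theorem one_add_natCast_eq_zero_iff {d n : ℕ} : (1 + n : ZMod d) = 0 ↔ d ∣ n + 1 := by
  rw [← ZMod.natCast_eq_zero_iff, Nat.cast_succ, add_comm]

theorem two_mul_div2_of_bodd_eq_false {n : ℕ} (h : n.bodd = false) : 2 * n.div2 = n := by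
  simpa [h] using n.bodd_add_div2

/-- The states of the automaton that recognizes the words `blocks (layout as c cs)` with positive
entries of `as` and `3 ∣ as.length + 1`. -/
inductive Phase : Type
  | start
  | startZero
  /-- after the block of length `1` and blocks of positive even lengths, `i` of them altogether -/
  | boundary (i : ZMod 3)
  /-- inside a block that follows `i` others; `odd` is the parity of the zeros read so far -/
  | block (i : ZMod 3) (odd : Bool)
  /-- inside the first block after the separator -/
  | lead (odd : Bool)
  /-- after that block; `last` is the letter read last -/
  | tail (last : Bool)
  | dead
  deriving Fintype

namespace Phase

/-- The automaton that recognizes the words `blocks (layout as c cs)` with positive entries of `as`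
and `3 ∣ as.length + 1`. -/
def dfa : DFA Bool Phase where
  step
    | start, false => startZero
    | startZero, true => boundary 1
    | boundary i, false => block i true
    | boundary i, true => if i = 0 then lead false else dead
    | block i odd, false => block i !odd
    | block i odd, true => if odd then dead else boundary (i + 1)
    | lead odd, false => lead !odd
    | lead odd, true => if odd then dead else tail true
    | tail _, a => tail a
    | _, _ => dead
  start := start
  accept := {tail true}

theorem evalFrom_dead (w : List Bool) : dfa.evalFrom dead w = dead := by
  induction w with
  | nil => rfl
  | cons _ _ ih => exact ih

theorem evalFrom_block_zerosOne (i : ZMod 3) (odd : Bool) (n : ℕ) :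
    dfa.evalFrom (block i odd) (zerosOne n) =
      if n.bodd = odd then boundary (i + 1) else dead := by
  induction n generalizing odd with
  | zero => cases odd <;> rfl
  | succ n ih =>
    rw [zerosOne_succ, DFA.evalFrom_cons]
    exact (ih !odd).trans (by simp [Bool.not_eq_eq_eq_not])

theorem evalFrom_boundary_zerosOne_succ (i : ZMod 3) (n : ℕ) :
    dfa.evalFrom (boundary i) (zerosOne (n + 1)) =
      if n.bodd then boundary (i + 1) else dead :=
  evalFrom_block_zerosOne i true n

theorem evalFrom_lead_zerosOne (odd : Bool) (n : ℕ) :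
    dfa.evalFrom (lead odd) (zerosOne n) = if n.bodd = odd then tail true else dead := by
  induction n generalizing odd with
  | zero => cases odd <;> rfl
  | succ n ih =>
    rw [zerosOne_succ, DFA.evalFrom_cons]
    exact (ih !odd).trans (by simp [Bool.not_eq_eq_eq_not])

theorem evalFrom_tail_zerosOne (last : Bool) (n : ℕ) :
    dfa.evalFrom (tail last) (zerosOne n) = tail true := by
  induction n generalizing last with
  | zero => rfl
  | succ _ ih => exact ih false

theorem evalFrom_boundary_map (i : ZMod 3) {as : List ℕ} (has : ∀ a ∈ as, 0 < a) :
    dfa.evalFrom (boundary i) (blocks (as.map (2 * ·))) = boundary (i + as.length) := by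
  induction as generalizing i with
  | nil => simp [blocks]
  | cons a as ih =>
    rw [List.forall_mem_cons] at has
    obtain ⟨a, rfl⟩ := Nat.exists_eq_succ_of_ne_zero has.1.ne'
    rw [List.map_cons, blocks_cons, DFA.evalFrom_of_append, Nat.mul_succ, Nat.add_succ,
      evalFrom_boundary_zerosOne_succ, if_pos (by simp), ih _ has.2]
    simp [add_assoc, add_comm (1 : ZMod 3)]

theorem evalFrom_tail_blocks (cs : List ℕ) : dfa.evalFrom (tail true) (blocks cs) = tail true := by
  induction cs with
  | nil => rfl
  | cons m cs ih => rw [blocks_cons, DFA.evalFrom_of_append, evalFrom_tail_zerosOne, ih]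

theorem blocks_layout_mem_accepts {as : List ℕ} (has : ∀ a ∈ as, 0 < a) (h3 : 3 ∣ as.length + 1)
    (c : ℕ) (cs : List ℕ) : blocks (layout as c cs) ∈ dfa.accepts := by
  have hstart : dfa.evalFrom dfa.start (zerosOne 1) = boundary 1 := rfl
  have hseparator : dfa.evalFrom (boundary 0) [true] = lead false := rfl
  simp only [DFA.mem_accepts, DFA.eval, blocks_layout, DFA.evalFrom_of_append, hstart,
    evalFrom_boundary_map _ has, one_add_natCast_eq_zero_iff.2 h3, hseparator,
    evalFrom_lead_zerosOne, Nat.bodd_mul, Nat.bodd_two, Bool.false_and, if_true,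
    evalFrom_tail_blocks]
  rfl

theorem eq_true_of_step_eq {q : Phase} {a : Bool} (h : dfa.step q a = tail true) : a = true := by
  rcases a with _ | _
  · cases q <;> cases h
  · rfl

theorem exists_blocks_of_mem_accepts {w : List Bool} (h : w ∈ dfa.accepts) :
    ∃ l, blocks l = w := by
  rcases List.eq_nil_or_concat' w with rfl | ⟨w, a, rfl⟩
  · cases h
  · obtain rfl : a = true :=
      eq_true_of_step_eq ((dfa.evalFrom_append_singleton _ _ _).symm.trans h)
    exact exists_blocks_eq_append_true w

theorem exists_cons_of_evalFrom_lead {l : List ℕ}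
    (h : dfa.evalFrom (lead false) (blocks l) = tail true) :
    ∃ (c : ℕ) (cs : List ℕ), l = 2 * c :: cs := by
  rcases l with _ | ⟨m, cs⟩
  · cases h
  · rw [blocks_cons, DFA.evalFrom_of_append, evalFrom_lead_zerosOne] at h
    split_ifs at h with hm
    · exact ⟨m.div2, cs, by rw [two_mul_div2_of_bodd_eq_false hm]⟩
    · cases (evalFrom_dead _).symm.trans h

theorem exists_of_evalFrom_boundary {i : ZMod 3} {l : List ℕ}
    (h : dfa.evalFrom (boundary i) (blocks l) = tail true) :
    ∃ (as : List ℕ) (c : ℕ) (cs : List ℕ), l = as.map (2 * ·) ++ 0 :: 2 * c :: cs ∧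
      (∀ a ∈ as, 0 < a) ∧ i + (as.length : ZMod 3) = 0 := by
  induction l generalizing i with
  | nil => cases h
  | cons m l ih =>
    rw [blocks_cons, DFA.evalFrom_of_append] at h
    rcases m with _ | m
    · change dfa.evalFrom (if i = 0 then lead false else dead) (blocks l) = _ at h
      split_ifs at h with hi
      · obtain ⟨c, cs, rfl⟩ := exists_cons_of_evalFrom_lead h
        exact ⟨[], c, cs, rfl, by simp, by simpa using hi⟩
      · cases (evalFrom_dead _).symm.trans h
    · rw [evalFrom_boundary_zerosOne_succ] at h
      split_ifs at h with hm
      · obtain ⟨as, c, cs, rfl, has, hi⟩ := ih h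
        have hdouble : 2 * (m + 1).div2 = m + 1 := two_mul_div2_of_bodd_eq_false (by simp [hm])
        refine ⟨(m + 1).div2 :: as, c, cs, ?_, ?_, ?_⟩
        · rw [List.map_cons, List.cons_append, hdouble]
        · exact List.forall_mem_cons.2 ⟨by omega, has⟩
        · rw [List.length_cons, Nat.cast_succ, add_comm (as.length : ZMod 3), ← add_assoc, hi]
      · cases (evalFrom_dead _).symm.trans h

theorem mem_accepts_iff {w : List Bool} : w ∈ dfa.accepts ↔
    ∃ (as : List ℕ) (c : ℕ) (cs : List ℕ), w = blocks (layout as c cs) ∧ (∀ a ∈ as, 0 < a) ∧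
      3 ∣ as.length + 1 := by
  constructor
  · intro h
    obtain ⟨_ | ⟨_ | _ | m, l⟩, rfl⟩ := exists_blocks_of_mem_accepts h
    · cases h
    · cases (evalFrom_dead _).symm.trans h
    · obtain ⟨as, c, cs, rfl, has, h3⟩ := exists_of_evalFrom_boundary h
      exact ⟨as, c, cs, rfl, has, one_add_natCast_eq_zero_iff.1 h3⟩
    · cases (evalFrom_dead _).symm.trans h
  · rintro ⟨as, c, cs, rfl, has, h3⟩
    exact blocks_layout_mem_accepts has h3 c cs

end Phase

namespace Phase

section Transcript

variable {T : MessageTest Bool Bool Phase} {f g : ℕ → List Bool}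

theorem emit_boundary_map (hT : T.toDFA = dfa)
    (hf : ∀ i a, T.emit (boundary i) (zerosOne (2 * (a + 1))) = f (a + 1))
    (i : ZMod 3) {as : List ℕ} (has : ∀ a ∈ as, 0 < a) :
    T.emit (boundary i) (blocks (as.map (2 * ·))) = as.flatMap f := by
  induction as generalizing i with
  | nil => rfl
  | cons a as ih =>
    rw [List.forall_mem_cons] at has
    obtain ⟨a, rfl⟩ := Nat.exists_eq_succ_of_ne_zero has.1.ne'
    rw [List.map_cons, blocks_cons, MessageTest.emit_append, hf, hT, Nat.mul_succ, Nat.add_succ,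
      evalFrom_boundary_zerosOne_succ, if_pos (by simp), ih _ has.2]
    rfl

theorem emit_tail_blocks (hT : T.toDFA = dfa) (hg : ∀ n, T.emit (tail true) (zerosOne n) = g n)
    (cs : List ℕ) : T.emit (tail true) (blocks cs) = cs.flatMap g := by
  induction cs with
  | nil => rfl
  | cons n cs ih =>
    rw [blocks_cons, MessageTest.emit_append, hg, hT, evalFrom_tail_zerosOne, ih]
    rfl

theorem transcript_blocks_layout (hT : T.toDFA = dfa)
    (hf : ∀ i a, T.emit (boundary i) (zerosOne (2 * (a + 1))) = f (a + 1))
    (hg : ∀ n, T.emit (tail true) (zerosOne n) = g n)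
    {as : List ℕ} (has : ∀ a ∈ as, 0 < a) (h3 : 3 ∣ as.length + 1) (c : ℕ) (cs : List ℕ) :
    T.transcript (blocks (layout as c cs)) =
      T.emit start (zerosOne 1) ++ as.flatMap f ++ T.emit (boundary 0) [true] ++
        T.emit (lead false) (zerosOne (2 * c)) ++ cs.flatMap g ++
        (T.expected (tail true) none).toList := by
  have hstart : dfa.evalFrom start (zerosOne 1) = boundary 1 := rfl
  have hmap : dfa.evalFrom (boundary 1) (blocks (as.map (2 * ·))) = boundary 0 := by
    rw [evalFrom_boundary_map 1 has, one_add_natCast_eq_zero_iff.2 h3]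
  have hseparator : dfa.evalFrom (boundary 0) [true] = lead false := rfl
  have hlead : dfa.evalFrom (lead false) (zerosOne (2 * c)) = tail true := by
    rw [evalFrom_lead_zerosOne, if_pos (by simp)]
  have hend : dfa.evalFrom start (blocks (layout as c cs)) = tail true :=
    blocks_layout_mem_accepts has h3 c cs
  have hT_start : T.start = start := congrArg DFA.start hT
  rw [MessageTest.transcript, MessageTest.transcriptFrom, hT_start, hT, hend, blocks_layout]
  simp only [MessageTest.emit_append, DFA.evalFrom_of_append, hT, hstart, hmap, hseparator, hlead,
    emit_boundary_map hT hf _ has, emit_tail_blocks hT hg]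

end Transcript

/-- The test that expects a copy of the input without the second letter of the separator `11`. -/
def copyTest : MessageTest Bool Bool Phase :=
  { dfa with expected := fun
      | boundary _, some true => none
      | _, a => a }

/-- The test that expects the block lengths `as ++ c :: cs` if the input is
`blocks (layout as c cs)`. As a message that passes `copyTest` has the block lengths
`1 :: as.map (2 * ·) ++ 2 * c :: cs`, each of these blocks is compared with its predecessor. -/
def doubleTest : MessageTest Bool Bool Phase :=
  { dfa with expected := fun
      | block _ false, some false => none
      | lead false, some false => none
      | block _ _, a => a
      | lead _, a => a
      | tail _, a => a
      | _, _ => none }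

/-- The test that expects a copy of the first part of the input, followed by a block that is as long
as the number of blocks in the second part. -/
def countTest : MessageTest Bool Bool Phase :=
  { dfa with expected := fun
      | boundary _, some true => none
      | lead _, some false => none
      | tail _, some false => none
      | lead _, some true => some false
      | tail _, some true => some false
      | _, none => some true
      | _, a => a }

variable {as : List ℕ}

theorem transcript_copyTest (has : ∀ a ∈ as, 0 < a) (h3 : 3 ∣ as.length + 1) (c : ℕ)
    (cs : List ℕ) : copyTest.transcript (blocks (layout as c cs)) =
      blocks (1 :: as.map (2 * ·) ++ 2 * c :: cs) := by
  have hblock (i odd n) : copyTest.emit (block i odd) (zerosOne n) = zerosOne n := by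
    induction n generalizing odd with
    | zero => cases odd <;> rfl
    | succ n ih => exact congrArg (false :: ·) (ih !odd)
  have hlead (odd n) : copyTest.emit (lead odd) (zerosOne n) = zerosOne n := by
    induction n generalizing odd with
    | zero => cases odd <;> rfl
    | succ n ih => exact congrArg (false :: ·) (ih !odd)
  have htail (last n) : copyTest.emit (tail last) (zerosOne n) = zerosOne n := by
    induction n generalizing last with
    | zero => rfl
    | succ n ih => exact congrArg (false :: ·) (ih false)
  have hboundary (i a) : copyTest.emit (boundary i) (zerosOne (2 * (a + 1))) =
      zerosOne (2 * (a + 1)) :=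
    congrArg (false :: ·) (hblock i true (2 * a + 1))
  rw [transcript_blocks_layout (f := fun a => zerosOne (2 * a)) rfl hboundary (htail true) has h3,
    hlead]
  change zerosOne 1 ++ _ ++ [] ++ _ ++ _ ++ [] = _
  simp [blocks, List.flatMap_map]

theorem transcript_doubleTest (has : ∀ a ∈ as, 0 < a) (h3 : 3 ∣ as.length + 1) (c : ℕ)
    (cs : List ℕ) : doubleTest.transcript (blocks (layout as c cs)) =
      blocks (as ++ c :: cs) := by
  have hboundary (i a) : doubleTest.emit (boundary i) (zerosOne (2 * (a + 1))) =
      zerosOne (a + 1) := by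
    change doubleTest.emit (block i true) (zerosOne (2 * a + 1)) = _
    induction a with
    | zero => rfl
    | succ n ih => exact congrArg (false :: ·) ih
  have hlead (n) : doubleTest.emit (lead false) (zerosOne (2 * n)) = zerosOne n := by
    induction n with
    | zero => rfl
    | succ n ih => exact congrArg (false :: ·) ih
  have htail (last n) : doubleTest.emit (tail last) (zerosOne n) = zerosOne n := by
    induction n generalizing last with
    | zero => rfl
    | succ n ih => exact congrArg (false :: ·) (ih false)
  rw [transcript_blocks_layout (f := zerosOne) rfl hboundary (htail true) has h3, hlead]
  change [] ++ _ ++ [] ++ _ ++ _ ++ [] = _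
  simp [blocks]

theorem transcript_countTest (has : ∀ a ∈ as, 0 < a) (h3 : 3 ∣ as.length + 1) (c : ℕ)
    (cs : List ℕ) : countTest.transcript (blocks (layout as c cs)) =
      blocks (1 :: as.map (2 * ·) ++ [cs.length + 1]) := by
  have hblock (i odd n) : countTest.emit (block i odd) (zerosOne n) = zerosOne n := by
    induction n generalizing odd with
    | zero => cases odd <;> rfl
    | succ n ih => exact congrArg (false :: ·) (ih !odd)
  have hlead (odd n) : countTest.emit (lead odd) (zerosOne n) = [false] := by
    induction n generalizing odd with
    | zero => cases odd <;> rfl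
    | succ _ ih => exact ih !odd
  have htail (last n) : countTest.emit (tail last) (zerosOne n) = [false] := by
    induction n generalizing last with
    | zero => rfl
    | succ _ ih => exact ih false
  have hboundary (i a) : countTest.emit (boundary i) (zerosOne (2 * (a + 1))) =
      zerosOne (2 * (a + 1)) :=
    congrArg (false :: ·) (hblock i true (2 * a + 1))
  have hsingle : cs.flatMap (fun _ => [false]) = List.replicate cs.length false := by
    rw [← List.map_eq_flatMap, List.map_const']
  rw [transcript_blocks_layout (f := fun a => zerosOne (2 * a)) rfl hboundary (htail true) has h3,
    hlead, hsingle]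
  change zerosOne 1 ++ _ ++ [] ++ [false] ++ _ ++ [true] = _
  simp [blocks, List.flatMap_map, zerosOne, List.replicate_succ]

end Phase

theorem eq_twoPowers_and_eq_replicate_of_startsWith
    {as cs : List ℕ} {c : ℕ} {y : Stream' Bool}
    (hcopy : StartsWith y (blocks (1 :: as.map (2 * ·) ++ 2 * c :: cs)))
    (hdouble : StartsWith y (blocks (as ++ c :: cs)))
    (hcount : StartsWith y (blocks (1 :: as.map (2 * ·) ++ [cs.length + 1]))) :
    as = twoPowers as.length ∧ c = 2 ^ as.length ∧
      cs = List.replicate (2 ^ (as.length + 1) - 1) (2 ^ (as.length + 1)) := by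
  have hprefix : as ++ c :: cs <+: 1 :: as.map (2 * ·) ++ 2 * c :: cs := by
    refine blocks_prefix_blocks.1 (hdouble.prefix_of_length_le hcopy ?_)
    have hsum : (as.map (2 * ·)).sum = 2 * as.sum :=
      List.sum_map_mul_left as id 2 |>.trans (by rw [List.map_id])
    simp only [length_blocks, List.sum_append, List.sum_cons, List.length_append,
      List.length_cons, List.length_map, hsum]
    omega
  obtain ⟨has, hc, hcs⟩ := append_cons_prefix_map_two_mul_iff.1 hprefix
  have hc' : 2 * c = 2 ^ (as.length + 1) := by rw [hc, pow_succ', mul_one]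
  have hlength : cs.length + 1 = 2 ^ (as.length + 1) :=
    hc' ▸ eq_of_startsWith_blocks hcount hcopy
  refine ⟨by simpa using has, by simpa using hc, ?_⟩
  rw [← hlength, Nat.add_sub_cancel, hlength, ← hc', ← hcs]

namespace Phase

/-- The three tests of the format of the input. -/
def formatTest : Fin 3 → MessageTest Bool Bool Phase := ![copyTest, doubleTest, countTest]

theorem formatTest_toDFA (i : Fin 3) : (formatTest i).toDFA = dfa := by
  fin_cases i <;> rfl

theorem forall_formatTest_iff {w : List Bool} {y : Stream' Bool} :
    (∀ i, w ∈ (formatTest i).accepts ∧ StartsWith y ((formatTest i).transcript w)) ↔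
      ∃ k, 0 < k ∧ w = dima2Word k ∧ StartsWith y (dima2Message k) := by
  simp only [formatTest_toDFA]
  constructor
  · intro h
    obtain ⟨as, c, cs, rfl, has, h3⟩ := mem_accepts_iff.1 (h 0).1
    have hcopy := transcript_copyTest has h3 c cs ▸ (h 0).2
    have hdouble := transcript_doubleTest has h3 c cs ▸ (h 1).2
    have hcount := transcript_countTest has h3 c cs ▸ (h 2).2
    obtain ⟨k, hk⟩ := h3
    obtain ⟨h1, h2, h3⟩ := eq_twoPowers_and_eq_replicate_of_startsWith hcopy hdouble hcount
    refine ⟨k, by omega, ?_, ?_⟩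
    · rw [dima2Word_eq_blocks_layout hk.symm, ← h1, ← h2, ← h3]
    · rw [dima2Message_eq_blocks hk.symm, ← h1, ← h2, ← h3]
      exact hcopy
  · rintro ⟨k, hk, rfl, hy⟩
    obtain ⟨j, hj⟩ : ∃ j, 3 * k = j + 1 := ⟨3 * k - 1, by omega⟩
    rw [dima2Message_eq_blocks hj] at hy
    have has (a) (ha : a ∈ twoPowers j) : 0 < a := pos_of_mem_twoPowers ha
    have h3 : 3 ∣ (twoPowers j).length + 1 := ⟨k, by rw [length_twoPowers, hj]⟩
    rw [dima2Word_eq_blocks_layout hj]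
    refine fun i => ⟨blocks_layout_mem_accepts has h3 _ _, ?_⟩
    fin_cases i
    · exact transcript_copyTest has h3 _ _ ▸ hy
    · refine transcript_doubleTest has h3 _ _ ▸ hy.of_prefix (blocks_prefix_blocks.2 ?_)
      exact append_cons_prefix_map_two_mul_iff.2 (by simp [length_twoPowers, pow_succ'])
    · refine transcript_countTest has h3 _ _ ▸ hy.of_prefix (blocks_prefix_blocks.2 ?_)
      simp [List.prefix_append_right_inj, List.cons_prefix_cons, ← pow_succ',
        Nat.sub_add_cancel Nat.one_le_two_pow]

end Phase

/-! ### The coin -/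

/-- The toss of a coin that shows `true`, called heads, with probability `p`. -/
noncomputable def coinToss (p : unitInterval) : PMF Bool :=
  PMF.ofFintype (fun b => ENNReal.ofReal (if b then p else 1 - p)) (by
    rw [Fintype.sum_bool, ← ENNReal.ofReal_add (by simpa using p.2.1) (by simpa using p.2.2)]
    simp)

theorem toReal_coinToss_bind {γ : Type} (p : unitInterval) (f : Bool → PMF γ) (c : γ) :
    ((coinToss p).bind f c).toReal = p * (f true c).toReal + (1 - p) * (f false c).toReal := by
  rw [toReal_bind_apply]
  simp [coinToss, ENNReal.toReal_ofReal p.2.1, ENNReal.toReal_ofReal (sub_nonneg.2 p.2.2)]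

/-- The distribution of the number of heads in `n` tosses. -/
noncomputable def headCount (p : unitInterval) : ℕ → PMF ℕ
  | 0 => PMF.pure 0
  | n + 1 => (coinToss p).bind fun b => (headCount p n).map (· + b.toNat)

-- Chebyshev's inequality: as a function of `n` and `M`, the left-hand side satisfies the recursion
-- of `headCount`.
theorem one_sub_div_sq_le_headCount_map {γ : Type} (p : unitInterval) {n : ℕ} {f : ℕ → γ} {c : γ}
    {M K : ℝ} (hK : 0 < K) (hf : ∀ h ≤ n, |(h : ℝ) - M| < K → f h = c) :
    1 - ((n * (p : ℝ) - M) ^ 2 + n * (p * (1 - p))) / K ^ 2 ≤ ((headCount p n).map f c).toReal := by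
  induction n generalizing f M with
  | zero =>
    by_cases hM : |M| < K
    · have hc : f 0 = c := hf 0 le_rfl (by simpa using hM)
      rw [headCount, PMF.pure_map, hc, PMF.pure_apply_self, ENNReal.toReal_one, Nat.cast_zero]
      simp only [zero_mul, add_zero]
      exact sub_le_self _ (by positivity)
    · refine le_trans ?_ ENNReal.toReal_nonneg
      rw [sub_nonpos, one_le_div (by positivity)]
      simpa [abs_of_pos hK] using sq_le_sq.2 ((abs_of_pos hK).trans_le (not_lt.1 hM))
  | succ n ih =>
    have hheads := ih (f := fun h => f (h + 1)) (M := M - 1) fun h hh hM =>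
      hf (h + 1) (by omega) (by rwa [Nat.cast_succ, ← sub_sub_eq_add_sub])
    have htails := ih (f := f) (M := M) fun h hh => hf h (by omega)
    rw [headCount, PMF.map_bind, toReal_coinToss_bind, PMF.map_comp, PMF.map_comp]
    calc _ = (p : ℝ) * (1 - ((n * (p : ℝ) - (M - 1)) ^ 2 + n * (p * (1 - p))) / K ^ 2) +
          (1 - (p : ℝ)) * (1 - ((n * (p : ℝ) - M) ^ 2 + n * (p * (1 - p))) / K ^ 2) := by
          push_cast
          field_simp
          ring
      _ ≤ _ := add_le_add (mul_le_mul_of_nonneg_left hheads p.2.1)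
          (mul_le_mul_of_nonneg_left htails (sub_nonneg.2 p.2.2))

/-- The states of the coin test. -/
inductive CoinPhase : Type
  /-- in the first part; `boundary` tells whether the next letter begins a block -/
  | header (boundary : Bool)
  /-- in the second part; `d` is the number, modulo `8`, of symbols `1` counted so far -/
  | count (d : ZMod 8)
  deriving Fintype

open CoinPhase in
/-- The verifier that skips a symbol of the message for each letter of the input up to the first
of two consecutive letters `1`, tosses a coin for each letter after the second, reads as many
symbols of the message as it gets heads, and checks whether the number of symbols `1` among them is
`4`, `5`, `6` or `7` modulo `8`. -/
noncomputable def coinTest (p : unitInterval) : StreamVerifier Bool Bool where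
  State := CoinPhase
  finite_state := inferInstance
  start := PMF.pure (header true)
  next
    | header true, some true => PMF.pure (.inl (count 0))
    | header _, some a => PMF.pure (.inr fun _ => header a)
    | count d, some _ => (coinToss p).map fun heads =>
        if heads then .inr fun c => count (if c then d + 1 else d) else .inl (count d)
    | q, none => PMF.pure (.inl q)
  accept
    | header _ => false
    | count d => decide (4 ≤ d.val)

namespace CoinPhase

variable {p : unitInterval}

theorem outcomeFrom_count (d : ZMod 8) (y : Stream' Bool) (v : List Bool) :
    (coinTest p).outcomeFrom (count d) y v = (headCount p v.length).map fun h =>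
      decide (4 ≤ (d + (y.take h).count true).val) := by
  induction v generalizing d y with
  | nil =>
    refine (PMF.pure_map _ _).trans ?_
    rw [List.length_nil, headCount, PMF.pure_map]
    simp [coinTest, StreamVerifier.settle]
  | cons a v ih =>
    rw [List.length_cons, headCount, PMF.map_bind]
    refine (PMF.bind_map _ _ _).trans (congrArg _ (funext fun heads => ?_))
    rw [PMF.map_comp]
    rcases heads with _ | _
    · exact ih d y
    · refine (ih _ y.tail).trans (congrArg (PMF.map · _) (funext fun h => ?_))
      rw [Function.comp_apply, Bool.toNat_true, Stream'.take_succ, List.count_cons]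
      cases y.head
      · simp
      · simp [add_assoc, add_comm (1 : ZMod 8)]

theorem outcomeFrom_header_zerosOne (m : ℕ) (y : Stream' Bool) (w : List Bool) :
    (coinTest p).outcomeFrom (header false) y (zerosOne m ++ w) =
      (coinTest p).outcomeFrom (header true) (y.drop (m + 1)) w := by
  induction m generalizing y with
  | zero => exact PMF.pure_bind _ _
  | succ m ih => exact (PMF.pure_bind _ _).trans (ih y.tail)

theorem outcomeFrom_header_blocks {l : List ℕ} (hl : ∀ m ∈ l, 0 < m) (y : Stream' Bool)
    (w : List Bool) : (coinTest p).outcomeFrom (header true) y (blocks l ++ true :: w) =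
      (coinTest p).outcomeFrom (count 0) (y.drop (blocks l).length) w := by
  induction l generalizing y with
  | nil => exact PMF.pure_bind _ _
  | cons m l ih =>
    rw [List.forall_mem_cons] at hl
    obtain ⟨m, rfl⟩ := Nat.exists_eq_succ_of_ne_zero hl.1.ne'
    rw [blocks_cons, List.length_append, length_zerosOne, ← Stream'.drop_drop, ← ih hl.2,
      List.append_assoc]
    exact (PMF.pure_bind _ _).trans (outcomeFrom_header_zerosOne m y.tail _)

theorem outcome_blocks {l : List ℕ} (hl : ∀ m ∈ l, 0 < m) (y : Stream' Bool) (v : List Bool) :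
    (coinTest p).outcome y (blocks l ++ true :: v) = (headCount p v.length).map fun h =>
      decide (4 ≤ ((y.drop (blocks l).length).take h).count true % 8) := by
  refine (PMF.pure_bind _ _).trans ?_
  rw [outcomeFrom_header_blocks hl, outcomeFrom_count]
  simp only [zero_add, ZMod.val_natCast]

end CoinPhase

theorem count_take_blocks_replicate {m r h : ℕ} (hh : h ≤ r * (m + 1)) :
    ((blocks (List.replicate r m)).take h).count true = h / (m + 1) := by
  induction r generalizing h with
  | zero => simp_all [blocks]
  | succ r ih =>
    rw [List.replicate_succ, blocks_cons]
    by_cases hm : h < m + 1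
    · rw [List.take_append_of_le_length (by rw [length_zerosOne]; omega), zerosOne,
        List.take_append_of_le_length (by rw [List.length_replicate]; omega), List.take_replicate,
        Nat.div_eq_of_lt hm, List.count_replicate]
      rfl
    · obtain ⟨h, rfl⟩ := Nat.exists_eq_add_of_le' (not_lt.1 hm)
      rw [Nat.succ_mul, Nat.add_le_add_iff_right] at hh
      rw [List.take_append, List.take_of_length_le (by rw [length_zerosOne]; omega),
        length_zerosOne, Nat.add_sub_cancel, List.count_append, ih hh,
        Nat.add_div_right _ m.succ_pos]
      simp [zerosOne, List.count_replicate, add_comm]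

theorem exists_pow_mul_ofDigits {b : ℕ} (a : ℕ → Fin b) (i : ℕ) :
    ∃ A : ℕ, ∃ r ∈ Set.Icc (0 : ℝ) 1,
      (b : ℝ) ^ (i + 1) * Real.ofDigits a = (b * A + a i : ℕ) + r := by
  have hb : (b : ℝ) ≠ 0 := Nat.cast_ne_zero.2 (a 0).pos.ne'
  have hshift (a : ℕ → Fin b) :
      b * Real.ofDigits a = a 0 + Real.ofDigits (fun l => a (l + 1)) := by
    rw [Real.ofDigits_eq_sum_add_ofDigits a 1, Finset.sum_range_one, Real.ofDigitsTerm]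
    simp only [zero_add, pow_one]
    field_simp
  induction i generalizing a with
  | zero =>
    refine ⟨0, Real.ofDigits fun l => a (l + 1),
      ⟨Real.ofDigits_nonneg _, Real.ofDigits_le_one _⟩, ?_⟩
    rw [zero_add, pow_one, hshift a, mul_zero, zero_add]
  | succ i ih =>
    obtain ⟨A, r, hr, h⟩ := ih fun l => a (l + 1)
    refine ⟨b ^ i * a 0 + A, r, hr, ?_⟩
    rw [pow_succ, mul_assoc, hshift a, mul_add, h]
    push_cast
    ring

open Classical in
/-- The octal digits of the bias of the coin. They are chosen such that an error of one unit in a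
digit does not affect whether the digit is at least `4`. -/
noncomputable def biasDigit (I : Set ℕ+) (i : ℕ) : Fin 8 := if i.succPNat ∈ I then 5 else 1

/-- The bias of the coin that encodes the set `I`. -/
noncomputable def bias (I : Set ℕ+) : unitInterval :=
  ⟨Real.ofDigits (biasDigit I), Real.ofDigits_nonneg _, Real.ofDigits_le_one _⟩

theorem le_div_add_one_and_div_le_add_one {h K n : ℕ} {r : ℝ} (hr : r ∈ Set.Icc (0 : ℝ) 1)
    (hh : |(h : ℝ) - K * (n + r)| < K) : n ≤ h / K + 1 ∧ h / K ≤ n + 1 := by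
  have hK : 0 < K := Nat.cast_pos.1 ((abs_nonneg _).trans_lt hh)
  obtain ⟨hlower, hupper⟩ := abs_sub_lt_iff.1 hh
  have hK0 : (0 : ℝ) ≤ K * r := mul_nonneg K.cast_nonneg hr.1
  have hK1 : K * r ≤ (K : ℝ) := mul_le_of_le_one_right K.cast_nonneg hr.2
  constructor
  · rw [← Nat.add_div_right _ hK, Nat.le_div_iff_mul_le hK]
    exact_mod_cast (by nlinarith : (n * K : ℝ) ≤ h + K)
  · rw [← Nat.lt_succ_iff, Nat.div_lt_iff_lt_mul hK]
    exact_mod_cast (by nlinarith : (h : ℝ) < (n + 1 + 1) * K)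

theorem four_le_div_mod_eight_iff_mem {I : Set ℕ+} {k : ℕ+} {h K : ℕ}
    (hh : |(h : ℝ) - K * (8 ^ (k : ℕ) * bias I)| < K) :
    4 ≤ h / K % 8 ↔ k ∈ I := by
  obtain ⟨A, r, hr, hA⟩ := exists_pow_mul_ofDigits (biasDigit I) k.natPred
  rw [PNat.natPred_add_one] at hA
  obtain ⟨hlower, hupper⟩ := le_div_add_one_and_div_le_add_one hr (hA ▸ hh)
  rw [biasDigit, PNat.succPNat_natPred] at hlower hupper
  by_cases hk : k ∈ I
  · rw [if_pos hk, Fin.coe_ofNat_eq_mod] at hlower hupper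
    simp only [hk, iff_true]
    omega
  · rw [if_neg hk, Fin.val_one] at hlower hupper
    simp only [hk, iff_false]
    omega

theorem one_sub_quarter_le_outcome_coinTest {I : Set ℕ+} {k : ℕ+} {y : Stream' Bool} {b : Bool}
    (hy : StartsWith y (dima2Message k)) (hb : b = true ↔ k ∈ I) :
    1 - 1 / 4 ≤ ((coinTest (bias I)).outcome y (dima2Word k) b).toReal := by
  set p := bias I
  set m := 2 ^ (3 * (k : ℕ))
  have hm : (m : ℝ) = 8 ^ (k : ℕ) := by simp [m, pow_mul]
  rw [dima2Message, blocks_append] at hy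
  rw [dima2Word_eq_blocks, blocks_append, blocks_cons, zerosOne_zero, List.singleton_append,
    CoinPhase.outcome_blocks fun _ => pos_of_mem_twoPowers]
  have hlength : (blocks (List.replicate m m)).length = m * (m + 1) := by
    simp [length_blocks, mul_add]
  rw [hlength]
  have hK : (0 : ℝ) < (m + 1 : ℕ) := Nat.cast_pos.2 m.succ_pos
  refine le_trans ?_ (one_sub_div_sq_le_headCount_map p (M := (m + 1 : ℕ) * (8 ^ (k : ℕ) * p)) hK
    fun h hh hM => ?_)
  · have hvar : (p : ℝ) * (1 - p) ≤ 1 / 4 := by nlinarith [sq_nonneg ((p : ℝ) - 1 / 2)]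
    have hm0 : (0 : ℝ) ≤ m := m.cast_nonneg
    rw [sub_le_sub_iff_left, div_le_iff₀ (pow_pos hK 2), ← hm]
    push_cast
    nlinarith [mul_le_mul_of_nonneg_left hvar (mul_nonneg hm0 (add_nonneg hm0 zero_le_one))]
  · rw [hy.drop.take_eq (hlength ▸ hh), count_take_blocks_replicate hh,
      Bool.eq_iff_iff, decide_eq_true_iff, hb]
    exact four_le_div_mod_eight_iff_mem hM

theorem dima2Word_mem_DIMA2Sub {I : Set ℕ+} {k : ℕ+} : dima2Word k ∈ DIMA2Sub I ↔ k ∈ I := by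
  constructor
  · rintro ⟨l, hl, h⟩
    have hlength := congrArg List.length ((isKthShortest_DIMA2_iff l l.pos _).1 h)
    rwa [PNat.coe_injective (dima2Word_length_strictMono.injective hlength)]
  · exact fun hk => ⟨k, hk, (isKthShortest_DIMA2_iff k k.pos _).2 rfl⟩

theorem DIMA2Sub_injective : Function.Injective DIMA2Sub := fun I J hIJ => by
  ext k
  rw [← dima2Word_mem_DIMA2Sub, hIJ, dima2Word_mem_DIMA2Sub]

theorem linearTimeSweepingVerifiable_DIMA2Sub (I : Set ℕ+) :
    LinearTimeSweepingVerifiable (DIMA2Sub I) := by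
  refine StreamVerifier.linearTimeSweepingVerifiable_of_tests
    (M := fun o : Option (Fin 3) =>
      o.elim (coinTest (bias I)) fun i => (Phase.formatTest i).toStreamVerifier)
    (δ := fun o => o.elim (1 / 4) 0) (fun o => ?_) ?_ (fun w hw => ?_) (fun w hw y => ?_)
  · cases o <;> norm_num
  · norm_num [Fintype.sum_option]
  · obtain ⟨k, hk, hw⟩ := hw
    obtain rfl := (isKthShortest_DIMA2_iff k k.pos w).1 hw
    have hy := StartsWith.append_stream (dima2Message k) (Stream'.const false)
    refine ⟨dima2Message k ++ₛ Stream'.const false, Option.rec ?_ fun i => ?_⟩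
    · exact one_sub_quarter_le_outcome_coinTest hy (iff_of_true rfl hk)
    · have := Phase.forall_formatTest_iff.2 ⟨k, k.pos, rfl, hy⟩ i
      simp [MessageTest.outcome_toStreamVerifier, this]
  · by_cases hformat : ∀ i, w ∈ (Phase.formatTest i).accepts ∧
        StartsWith y ((Phase.formatTest i).transcript w)
    · obtain ⟨k, hk, rfl, hy⟩ := Phase.forall_formatTest_iff.1 hformat
      lift k to ℕ+ using hk
      rw [dima2Word_mem_DIMA2Sub] at hw
      exact ⟨none, one_sub_quarter_le_outcome_coinTest hy (iff_of_false Bool.false_ne_true hw)⟩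
    · obtain ⟨i, hi⟩ := not_forall.1 hformat
      refine ⟨some i, ?_⟩
      simp [MessageTest.outcome_toStreamVerifier, hi]

theorem theorem9 :
    (∀ I : Set ℕ+, LinearTimeSweepingVerifiable (DIMA2Sub I)) ∧
    ¬ {L : Language Bool | LinearTimeSweepingVerifiable L}.Countable := by
  refine ⟨linearTimeSweepingVerifiable_DIMA2Sub, fun hcount => ?_⟩
  have : Countable (Set ℕ+) := Set.countable_univ_iff.1 <|
    (hcount.preimage_of_injOn DIMA2Sub_injective.injOn).mono fun I _ =>
      linearTimeSweepingVerifiable_DIMA2Sub I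
  obtain ⟨f, hf⟩ := exists_injective_nat (Set ℕ+)
  exact Function.cantor_injective (fun I => (f I).succPNat) (Nat.succPNat_injective.comp hf)
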